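/- Let $n\ge 1$ and let $S^{n-1}$ be the unit sphere of $\mathbb{R}^n$, with geodesic distance $d(x,y)=\arccos\langle x,y\rangle\in[0,\pi]$ (the angle between $x$ and $y$). For $\delta>0$ and a Borel probability measure $\mu$ on $S^{n-1}$, define the geodesic energy integral $$G_\delta(\mu)=\int_{S^{n-1}}\int_{S^{n-1}} d(x,y)^\delta\,d\mu(x)\,d\mu(y).$$ The maximizers of $G_\delta$ over all Borel probability measures on $S^{n-1}$ are characterized as follows. (a) If $0<\delta<1$, the unique maximizer of $G_\delta$ is the uniform measure $\sigma$, that is, the normalized surface measure on $S^{n-1}$. (b) If $\delta=1$, a Borel probability measure $\mu$ maximizes $G_\delta$ if and only if $\mu$ is centrally symmetric, that is, invariant under $x\mapsto -x$. (c) If $\delta>1$, a Borel probability measure $\mu$ maximizes $G_\delta$ if and only if $\mu=\frac12(\delta_p+\delta_{-p})$ for some $p\in S^{n-1}$, where $\delta_p$ denotes the unit point mass at $p$. -/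

import Mathlib

open MeasureTheory

/-- The unit sphere `S^{n-1}` of the Euclidean space `ℝⁿ`, with its Borel σ-algebra. -/
abbrev UnitSphere (n : ℕ) : Type := Metric.sphere (0 : EuclideanSpace ℝ (Fin n)) 1

/-- The geodesic distance on `S^{n-1}`: the angle `arccos ⟪x, y⟫ ∈ [0, π]` between `x` and `y`. -/
noncomputable def geodesicDist {n : ℕ} (x y : UnitSphere n) : ℝ :=
  InnerProductGeometry.angle (x : EuclideanSpace ℝ (Fin n)) (y : EuclideanSpace ℝ (Fin n))

theorem geodesicDist_eq_arccos {n : ℕ} (x y : UnitSphere n) :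
    geodesicDist x y =
      Real.arccos (inner ℝ (x : EuclideanSpace ℝ (Fin n)) (y : EuclideanSpace ℝ (Fin n))) := by
  simp [geodesicDist, InnerProductGeometry.angle]

/-- The geodesic energy `G_δ(μ) = ∬ d(x,y)^δ dμ(x) dμ(y)`. For `0 < δ` and `μ` finite the integrand
is continuous and bounded by `π ^ δ`, hence integrable. -/
noncomputable def geodesicEnergy {n : ℕ} (δ : ℝ) (μ : Measure (UnitSphere n)) : ℝ :=
  ∫ y, ∫ x, geodesicDist x y ^ δ ∂μ ∂μ

/-- `μ` is a maximizer of `G_δ` over the Borel probability measures on `S^{n-1}`. -/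
def IsGeodesicEnergyMaximizer {n : ℕ} (δ : ℝ) (μ : Measure (UnitSphere n)) : Prop :=
  IsProbabilityMeasure μ ∧
    ∀ ν : Measure (UnitSphere n), IsProbabilityMeasure ν → geodesicEnergy δ ν ≤ geodesicEnergy δ μ

/-- The uniform measure on `S^{n-1}`: the surface measure, normalized to total mass one
(for `1 ≤ n`). -/
noncomputable def uniformSphereMeasure (n : ℕ) : Measure (UnitSphere n) :=
  ((volume : Measure (EuclideanSpace ℝ (Fin n))).toSphere Set.univ)⁻¹ •
    (volume : Measure (EuclideanSpace ℝ (Fin n))).toSphere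

/-- `μ` is centrally symmetric: it is invariant under the antipodal map `x ↦ -x`. -/
def IsCentrallySymmetric {n : ℕ} (μ : Measure (UnitSphere n)) : Prop :=
  μ.map (fun x => -x) = μ

/-! A kernel `g ⟪x, y⟫` whose power series has nonnegative coefficients is positive definite: `⟪x,
y⟫ ^ k` expands into products of monomials, so the energy is a sum of squared moments with weights
`a k`. Moments determine a measure, so the positive weights decide the equality cases.

For `δ = 1`, `arccos = π/2 - arcsin`, and the arcsine series has positive coefficients exactly where
needed, at odd degrees. The energy is thus at most `π/2`, with equality iff all odd moments vanish,
which is central symmetry.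

For `δ > 1`, `t ^ δ ≤ π ^ (δ - 1) * t` on `[0, π]` reduces the bound to `δ = 1`; equality also
forces distances into `{0, π}` almost everywhere.

For `δ < 1`, `d ^ δ = (π/2) ^ δ * (1 - g ⟪x, y⟫)` with `g t = 1 - (1 - (2/π) arcsin t) ^ δ`, a
composition of nonnegative series with every coefficient of degree `k ≥ 1` positive. The uniform
measure σ has constant potential, so the energy excess of μ over σ for `g` is the energy of `μ - σ`:
it is nonnegative, and zero only if all moments agree. -/

/-- `g` is the sum on `[-1, 1]` of the power series with nonnegative coefficients `a`. -/
structure HasNonnegSeries (a : ℕ → ℝ) (g : ℝ → ℝ) : Prop where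
  nonneg : ∀ k, 0 ≤ a k
  hasSum : ∀ t ∈ Set.Icc (-1 : ℝ) 1, HasSum (fun k => a k * t ^ k) (g t)

/-! ### Calculus of power series with nonnegative coefficients -/

namespace HasNonnegSeries

variable {a b : ℕ → ℝ} {f g : ℝ → ℝ}

theorem hasSum_one (h : HasNonnegSeries a g) : HasSum a (g 1) := by
  simpa using h.hasSum 1 (by norm_num)

theorem summable (h : HasNonnegSeries a g) : Summable a := h.hasSum_one.summable

theorem abs_le (h : HasNonnegSeries a g) {t : ℝ} (ht : t ∈ Set.Icc (-1 : ℝ) 1) :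
    |g t| ≤ g 1 := by
  rw [← (h.hasSum t ht).tsum_eq, ← h.hasSum_one.tsum_eq, ← Real.norm_eq_abs]
  refine tsum_of_norm_bounded h.summable.hasSum fun k => ?_
  rw [Real.norm_eq_abs, abs_mul, abs_pow, abs_of_nonneg (h.nonneg k)]
  exact mul_le_of_le_one_right (h.nonneg k) (pow_le_one₀ (abs_nonneg t) (_root_.abs_le.2 ht))

/-- A power series with nonnegative coefficients which sums on `(-1, 1)` to a function continuous
on `[-1, 1]` also represents this function at the end points. -/
theorem of_Ioo (ha : ∀ k, 0 ≤ a k) (hg : ContinuousOn g (Set.Icc (-1) 1))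
    (hs : ∀ t ∈ Set.Ioo (-1 : ℝ) 1, HasSum (fun k => a k * t ^ k) (g t)) :
    HasNonnegSeries a g := by
  -- Each partial sum at `t < 1` is at most `g t`; letting `t → 1` bounds the partial sums of `a` by
  -- `g 1`.
  have hsum : Summable a := by
    refine summable_of_sum_le (c := g 1) ha fun s => ?_
    have hlim : Filter.Tendsto g (nhdsWithin 1 (Set.Ioo (-1) 1)) (nhds (g 1)) :=
      (hg 1 (by norm_num)).mono_left (nhdsWithin_mono _ Set.Ioo_subset_Icc_self)
    have hpoly : Filter.Tendsto (fun t : ℝ => ∑ k ∈ s, a k * t ^ k)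
        (nhdsWithin 1 (Set.Ioo (-1) 1)) (nhds (∑ k ∈ s, a k)) := by
      have : Continuous (fun t : ℝ => ∑ k ∈ s, a k * t ^ k) := by fun_prop
      simpa using (this.tendsto 1).mono_left nhdsWithin_le_nhds
    have hne : (nhdsWithin (1 : ℝ) (Set.Ioo (-1) 1)).NeBot := by
      rw [nhdsWithin_Ioo_eq_nhdsLT (by norm_num)]
      infer_instance
    refine le_of_tendsto_of_tendsto hpoly hlim ?_
    have h0 : ∀ᶠ t : ℝ in nhdsWithin 1 (Set.Ioo (-1) 1), 0 < t :=
      mem_nhdsWithin_of_mem_nhds (lt_mem_nhds one_pos)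
    filter_upwards [self_mem_nhdsWithin, h0] with t ht ht0
    exact sum_le_hasSum s (fun k _ => mul_nonneg (ha k) (by positivity)) (hs t ht)
  have hb : ∀ k, ∀ t ∈ Set.Icc (-1 : ℝ) 1, ‖a k * t ^ k‖ ≤ a k := fun k t ht => by
    rw [Real.norm_eq_abs, abs_mul, abs_pow, abs_of_nonneg (ha k)]
    exact mul_le_of_le_one_right (ha k) (pow_le_one₀ (abs_nonneg t) (_root_.abs_le.2 ht))
  have hc : ContinuousOn (fun t : ℝ => ∑' k, a k * t ^ k) (Set.Icc (-1) 1) :=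
    continuousOn_tsum (fun k => by fun_prop) hsum hb
  have heq : Set.EqOn (fun t : ℝ => ∑' k, a k * t ^ k) g (Set.Icc (-1) 1) := by
    refine Set.EqOn.of_subset_closure (s := Set.Ioo (-1) 1) (fun t ht => (hs t ht).tsum_eq)
      hc hg Set.Ioo_subset_Icc_self ?_
    rw [closure_Ioo (by norm_num)]
  refine ⟨ha, fun t ht => ?_⟩
  rw [← heq ht]
  exact (Summable.of_norm_bounded hsum fun k => hb k t ht).hasSum

/-- Termwise integration of a power series with nonnegative coefficients. -/
theorem of_hasDerivAt {f' : ℝ → ℝ} (hb : ∀ k, 0 ≤ b k) (hf : ContinuousOn f (Set.Icc (-1) 1))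
    (hf0 : f 0 = 0) (hd : ∀ t ∈ Set.Ioo (-1 : ℝ) 1, HasDerivAt f (f' t) t)
    (hs : ∀ t ∈ Set.Ioo (-1 : ℝ) 1, HasSum (fun k => b k * t ^ k) (f' t)) :
    HasNonnegSeries (fun k => b (k - 1) / k) f := by
  refine of_Ioo (fun k => by have := hb (k - 1); positivity) hf ?_
  -- Termwise differentiation needs a uniform majorant, available on `(-r, r)` as `b k * r ^ k`.
  have key : ∀ r : ℝ, 0 < r → r < 1 → ∀ t ∈ Set.Ioo (-r) r,
      Summable (fun k => b k / (k + 1) * t ^ (k + 1)) ∧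
      HasDerivAt (fun z => ∑' k, b k / (k + 1) * z ^ (k + 1)) (f' t) t := by
    intro r hr0 hr1 t ht
    have hu : Summable fun k => b k * r ^ k := (hs r ⟨by linarith, hr1⟩).summable
    have hder : ∀ (k : ℕ) (y : ℝ), y ∈ Set.Ioo (-r) r →
        HasDerivAt (fun z : ℝ => b k / (k + 1) * z ^ (k + 1)) (b k * y ^ k) y := by
      intro k y _
      have := (hasDerivAt_pow (k + 1) y).const_mul (b k / (k + 1))
      refine this.congr_deriv ?_
      rw [Nat.add_sub_cancel]
      push_cast
      field_simp
    have hbd : ∀ (k : ℕ) (y : ℝ), y ∈ Set.Ioo (-r) r → ‖b k * y ^ k‖ ≤ b k * r ^ k := by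
      intro k y hy
      rw [Real.norm_eq_abs, abs_mul, abs_pow, abs_of_nonneg (hb k)]
      exact mul_le_mul_of_nonneg_left
        (pow_le_pow_left₀ (abs_nonneg y) (abs_lt.2 hy).le k) (hb k)
    have h0 : (0 : ℝ) ∈ Set.Ioo (-r) r := ⟨by linarith, hr0⟩
    have hs0 : Summable fun k : ℕ => b k / (k + 1) * (0 : ℝ) ^ (k + 1) := by
      simp
    refine ⟨summable_of_summable_hasDerivAt_of_isPreconnected
      (g := fun k (z : ℝ) => b k / (k + 1) * z ^ (k + 1)) (g' := fun k y => b k * y ^ k)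
      hu isOpen_Ioo isPreconnected_Ioo hder hbd h0 hs0 ht, ?_⟩
    have := hasDerivAt_tsum_of_isPreconnected
      (g := fun k (z : ℝ) => b k / (k + 1) * z ^ (k + 1)) (g' := fun k y => b k * y ^ k)
      hu isOpen_Ioo isPreconnected_Ioo hder hbd h0 hs0 ht
    rwa [(hs t ⟨by linarith [ht.1], by linarith [ht.2]⟩).tsum_eq] at this
  have key' : ∀ t ∈ Set.Ioo (-1 : ℝ) 1,
      Summable (fun k => b k / (k + 1) * t ^ (k + 1)) ∧
      HasDerivAt (fun z => ∑' k, b k / (k + 1) * z ^ (k + 1)) (f' t) t := by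
    intro t ht
    obtain ⟨r, hr1, hr2⟩ := exists_between (abs_lt.2 ht)
    exact key r ((abs_nonneg t).trans_lt hr1) hr2 t (abs_lt.1 hr1)
  have heq : Set.EqOn (fun z => ∑' k, b k / (k + 1) * z ^ (k + 1)) f (Set.Ioo (-1) 1) := by
    refine isOpen_Ioo.eqOn_of_deriv_eq isPreconnected_Ioo
      (fun t ht => (key' t ht).2.differentiableAt.differentiableWithinAt)
      (fun t ht => (hd t ht).differentiableAt.differentiableWithinAt)
      (fun t ht => by rw [(key' t ht).2.deriv, (hd t ht).deriv]) (x := 0) (by norm_num) ?_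
    simp [hf0]
  intro t ht
  -- The term `k = 0` vanishes because its coefficient is a division by zero, so the index can be
  -- shifted.
  rw [← hasSum_nat_add_iff' 1]
  simp only [Finset.range_one, Finset.sum_singleton, Nat.cast_zero, div_zero, zero_mul, sub_zero,
    Nat.add_sub_cancel, Nat.cast_add, Nat.cast_one]
  rw [← heq ht]
  exact (key' t ht).1.hasSum

/-- Iterated Cauchy products. The lower bound keeps only the contribution of the linear term of `g`;
it is what makes coefficients of a composition strictly positive. -/
theorem pow_one_le (h : HasNonnegSeries a g) (j : ℕ) :
    ∃ c : ℕ → ℝ, HasNonnegSeries c (fun t => g t ^ j) ∧ a 1 ^ j ≤ c j := by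
  induction j with
  | zero =>
    refine ⟨fun k => if k = 0 then 1 else 0, ⟨fun k => by split_ifs <;> norm_num, fun t _ => ?_⟩,
      by simp⟩
    convert hasSum_ite_eq (0 : ℕ) (1 : ℝ) using 1
    · ext k
      split_ifs with hk <;> simp [hk]
    · simp
  | succ j ih =>
    obtain ⟨c, hc, hcj⟩ := ih
    refine ⟨fun k => ∑ p ∈ Finset.HasAntidiagonal.antidiagonal k, c p.1 * a p.2,
      ⟨fun k => Finset.sum_nonneg fun p _ => mul_nonneg (hc.nonneg _) (h.nonneg _), ?_⟩, ?_⟩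
    · intro t ht
      have h1 := hc.hasSum t ht
      have h2 := h.hasSum t ht
      have hsum := summable_norm_sum_mul_antidiagonal_of_summable_norm h1.summable.norm
        h2.summable.norm
      have htot := tsum_mul_tsum_eq_tsum_sum_antidiagonal_of_summable_norm h1.summable.norm
        h2.summable.norm
      rw [h1.tsum_eq, h2.tsum_eq] at htot
      have := hsum.of_norm.hasSum
      rw [← htot] at this
      refine Eq.subst (motive := fun w : ℕ → ℝ => HasSum w _) (funext fun k => ?_) this
      rw [Finset.sum_mul]
      refine Finset.sum_congr rfl fun p hp => ?_
      rw [← Finset.HasAntidiagonal.mem_antidiagonal.1 hp, pow_add]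
      ring
    · calc a 1 ^ (j + 1) = a 1 ^ j * a 1 := pow_succ _ _
        _ ≤ c j * a 1 := mul_le_mul_of_nonneg_right hcj (h.nonneg 1)
        _ ≤ _ := Finset.single_le_sum (f := fun p : ℕ × ℕ => c p.1 * a p.2)
            (fun p _ => mul_nonneg (hc.nonneg _) (h.nonneg _))
            (Finset.HasAntidiagonal.mem_antidiagonal.2 (rfl : (j, 1).1 + (j, 1).2 = j + 1))

/-- Composition of power series with nonnegative coefficients. -/
theorem comp (hf : HasNonnegSeries b f) (hg : HasNonnegSeries a g) (hg1 : g 1 ≤ 1) :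
    ∃ c : ℕ → ℝ, HasNonnegSeries c (fun t => f (g t)) ∧ ∀ k, b k * a 1 ^ k ≤ c k := by
  choose u hu hu1 using hg.pow_one_le
  have h01 : 0 ≤ g 1 := (abs_nonneg _).trans (hg.abs_le (by norm_num : (1 : ℝ) ∈ Set.Icc (-1) 1))
  -- Row `j` sums to `b j * g 1 ^ j ≤ b j`; this is where `g 1 ≤ 1` enters, and it allows the double
  -- sum to be rearranged.
  have hS : Summable fun p : ℕ × ℕ => b p.1 * u p.1 p.2 := by
    have hfib : ∀ j, HasSum (fun k => b j * u j k) (b j * g 1 ^ j) := fun j =>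
      (hu j).hasSum_one.mul_left (b j)
    refine (summable_prod_of_nonneg fun p => mul_nonneg (hf.nonneg _) ((hu _).nonneg _)).2
      ⟨fun j => (hfib j).summable, ?_⟩
    refine Summable.of_nonneg_of_le (fun j => tsum_nonneg fun k =>
      mul_nonneg (hf.nonneg _) ((hu _).nonneg _)) (fun j => ?_) hf.summable
    refine (hfib j).tsum_eq.le.trans ?_
    exact mul_le_of_le_one_right (hf.nonneg j) (pow_le_one₀ h01 hg1)
  have hS' : ∀ k, Summable fun j => b j * u j k := fun k => hS.prod_symm.prod_factor k
  refine ⟨fun k => ∑' j, b j * u j k, ⟨fun k => tsum_nonneg fun j =>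
    mul_nonneg (hf.nonneg _) ((hu _).nonneg _), fun t ht => ?_⟩, fun k => ?_⟩
  · have hSt : Summable fun p : ℕ × ℕ => b p.1 * (u p.1 p.2 * t ^ p.2) := by
      refine Summable.of_norm_bounded hS fun p => ?_
      rw [← mul_assoc, Real.norm_eq_abs, abs_mul, abs_pow,
        abs_of_nonneg (mul_nonneg (hf.nonneg _) ((hu _).nonneg _))]
      exact mul_le_of_le_one_right (mul_nonneg (hf.nonneg _) ((hu _).nonneg _))
        (pow_le_one₀ (abs_nonneg t) (_root_.abs_le.2 ht))
    have h1 := hSt.hasSum.prod_fiberwise fun j => ((hu j).hasSum t ht).mul_left (b j)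
    have h2 := hf.hasSum (g t) (_root_.abs_le.1 ((hg.abs_le ht).trans hg1))
    rw [h2.unique h1]
    have h3 : ∀ k, HasSum (fun j => b j * (u j k * t ^ k)) ((∑' j, b j * u j k) * t ^ k) :=
      fun k => by simpa only [mul_assoc] using (hS' k).hasSum.mul_right (t ^ k)
    exact HasSum.prod_fiberwise (f := fun p : ℕ × ℕ => b p.2 * (u p.2 p.1 * t ^ p.1))
      ((Equiv.prodComm ℕ ℕ).hasSum_iff.2 hSt.hasSum) h3
  · exact (mul_le_mul_of_nonneg_left (hu1 k) (hf.nonneg k)).trans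
      ((hS' k).le_tsum k fun j _ => mul_nonneg (hf.nonneg _) ((hu _).nonneg _))

end HasNonnegSeries

/-! ### The binomial and arcsine series -/

/-- The binomial series of `(1 - x)⁻ᵃ` has positive coefficients when `a > 0`. -/
theorem exists_hasSum_one_sub_rpow_neg {a : ℝ} (ha : 0 < a) :
    ∃ b : ℕ → ℝ, (∀ k, 0 < b k) ∧
      ∀ t ∈ Set.Ioo (-1 : ℝ) 1, HasSum (fun k => b k * t ^ k) ((1 - t) ^ (-a)) := by
  refine ⟨fun k => Ring.choose (a + k - 1) k, fun k => ?_, fun t ht => ?_⟩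
  · have h := Ring.factorial_nsmul_multichoose_eq_ascPochhammer a k
    have hp := ascPochhammer_pos k a ha
    simp only [← Ring.multichoose_eq]
    rw [Polynomial.ascPochhammer_smeval_eq_eval] at h
    rw [← h, nsmul_eq_mul] at hp
    exact pos_of_mul_pos_right hp (by positivity)
  · have h := (Real.one_div_one_sub_rpow_hasFPowerSeriesOnBall_zero a).hasSum (y := t) (by
      simpa [enorm_eq_nnnorm, ← NNReal.coe_lt_coe] using abs_lt.2 ht)
    have h1 : 0 ≤ 1 - t := by linarith [ht.2]
    simpa [FormalMultilinearSeries.ofScalars_apply_eq, Real.rpow_neg h1, mul_comm] using h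

/-- The power series of `arcsin`. -/
theorem exists_hasNonnegSeries_arcsin :
    ∃ a : ℕ → ℝ, HasNonnegSeries a Real.arcsin ∧ ∀ k, Odd k → 0 < a k := by
  obtain ⟨b, hb, hs⟩ := exists_hasSum_one_sub_rpow_neg (a := 1 / 2) (by norm_num)
  -- The derivative is the series of `(1 - x) ^ (-1/2)` at `x = t ^ 2`, hence supported on even
  -- degrees.
  refine ⟨_, HasNonnegSeries.of_hasDerivAt (b := fun k => if Even k then b (k / 2) else 0)
    (f' := fun t => 1 / Real.sqrt (1 - t ^ 2))
    (fun k => by split_ifs <;> simp [(hb _).le])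
    Real.continuous_arcsin.continuousOn Real.arcsin_zero
    (fun t ht => Real.hasDerivAt_arcsin ht.1.ne' ht.2.ne) (fun t ht => ?_), fun k hk => ?_⟩
  · have h2 : t ^ 2 < 1 := by nlinarith [ht.1, ht.2]
    have h := hs (t ^ 2) ⟨by nlinarith, h2⟩
    rw [Real.rpow_neg (by linarith), ← Real.sqrt_eq_rpow, ← one_div] at h
    have hinj : Function.Injective fun k : ℕ => 2 * k := fun x y hxy => by
      simpa using hxy
    rw [← hinj.hasSum_iff]
    · convert h using 2 with k
      simp [pow_mul]
    · intro k hk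
      have : ¬ Even k := fun ⟨j, hj⟩ => hk ⟨j, by simp only; omega⟩
      simp [this]
  · obtain ⟨j, rfl⟩ := hk
    simp only [Nat.add_sub_cancel, even_two, Even.mul_right, if_true]
    have := hb (2 * j / 2)
    positivity

/-- The power series of `1 - (1 - x) ^ δ`, for `0 < δ < 1`. -/
theorem exists_hasNonnegSeries_one_sub_rpow {δ : ℝ} (h0 : 0 < δ) (h1 : δ < 1) :
    ∃ a : ℕ → ℝ, HasNonnegSeries a (fun t => 1 - (1 - t) ^ δ) ∧ ∀ k, k ≠ 0 → 0 < a k := by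
  obtain ⟨b, hb, hs⟩ := exists_hasSum_one_sub_rpow_neg (a := 1 - δ) (by linarith)
  refine ⟨_, HasNonnegSeries.of_hasDerivAt (b := fun k => δ * b k)
    (f' := fun t => δ * (1 - t) ^ (-(1 - δ)))
    (fun k => by have := hb k; positivity) ?_ (by simp) (fun t ht => ?_) (fun t ht => ?_),
    fun k hk => ?_⟩
  · exact Continuous.continuousOn (by
      refine continuous_const.sub ?_
      exact (continuous_const.sub continuous_id).rpow_const fun _ => Or.inr h0.le)
  · have h : HasDerivAt (fun t : ℝ => 1 - t) (-1) t := by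
      simpa using (hasDerivAt_id t).const_sub 1
    have := (h.rpow_const (p := δ) (Or.inl (by linarith [ht.2]))).const_sub 1
    refine this.congr_deriv ?_
    rw [neg_sub]
    ring
  · simpa only [mul_assoc] using (hs t ht).mul_left δ
  · have := hb (k - 1)
    have : (0 : ℝ) < k := by exact_mod_cast Nat.pos_of_ne_zero hk
    positivity

/-! ### Moments and positive definite energies on the sphere -/

section Moments

variable {n : ℕ}

/-- The moment of `μ` against the monomial `x ↦ ∏ j, x (f j)`. -/
noncomputable def sphereMoment (μ : Measure (UnitSphere n)) {k : ℕ} (f : Fin k → Fin n) : ℝ :=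
  ∫ x, ∏ j, (x : EuclideanSpace ℝ (Fin n)) (f j) ∂μ

/-- The mutual energy of `μ` and `ν` for the kernel `g ⟪x, y⟫`. -/
noncomputable def sphereEnergy (g : ℝ → ℝ) (μ ν : Measure (UnitSphere n)) : ℝ :=
  ∫ z, g (inner ℝ (z.1 : EuclideanSpace ℝ (Fin n)) (z.2 : EuclideanSpace ℝ (Fin n))) ∂μ.prod ν

theorem Continuous.integrable_of_compactSpace {X : Type*} [TopologicalSpace X] [CompactSpace X]
    [MeasurableSpace X] [OpensMeasurableSpace X] {μ : Measure X} [IsFiniteMeasure μ] {f : X → ℝ}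
    (hf : Continuous f) : Integrable f μ :=
  hf.integrable_of_hasCompactSupport (HasCompactSupport.of_compactSpace f)

theorem inner_mem_Icc (x y : UnitSphere n) :
    inner ℝ (x : EuclideanSpace ℝ (Fin n)) (y : EuclideanSpace ℝ (Fin n)) ∈
      Set.Icc (-1 : ℝ) 1 := by
  have := abs_real_inner_le_norm (x : EuclideanSpace ℝ (Fin n)) (y : EuclideanSpace ℝ (Fin n))
  rw [norm_eq_of_mem_sphere x, norm_eq_of_mem_sphere y, one_mul] at this
  exact abs_le.1 this

theorem inner_pow_eq_sum (x y : EuclideanSpace ℝ (Fin n)) (k : ℕ) :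
    inner ℝ x y ^ k = ∑ f : Fin k → Fin n, (∏ j, x (f j)) * ∏ j, y (f j) := by
  rw [PiLp.inner_apply, Fintype.sum_pow]
  refine Finset.sum_congr rfl fun f _ => ?_
  rw [← Finset.prod_mul_distrib]
  exact Finset.prod_congr rfl fun j _ => by simp [mul_comm]

theorem sphereEnergy_pow (μ ν : Measure (UnitSphere n)) [IsFiniteMeasure μ] [IsFiniteMeasure ν]
    (k : ℕ) : sphereEnergy (fun t => t ^ k) μ ν =
      ∑ f : Fin k → Fin n, sphereMoment μ f * sphereMoment ν f := by
  simp only [sphereEnergy, inner_pow_eq_sum]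
  rw [integral_finsetSum]
  · exact Finset.sum_congr rfl fun f _ => integral_prod_mul
      (fun x : UnitSphere n => ∏ j, (x : EuclideanSpace ℝ (Fin n)) (f j))
      (fun x : UnitSphere n => ∏ j, (x : EuclideanSpace ℝ (Fin n)) (f j))
  · intro f _
    exact Continuous.integrable_of_compactSpace (by fun_prop)

theorem HasNonnegSeries.hasSum_sphereEnergy {a : ℕ → ℝ} {g : ℝ → ℝ} (h : HasNonnegSeries a g)
    (μ ν : Measure (UnitSphere n)) [IsProbabilityMeasure μ] [IsProbabilityMeasure ν] :
    HasSum (fun k => a k * ∑ f : Fin k → Fin n, sphereMoment μ f * sphereMoment ν f)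
      (sphereEnergy g μ ν) := by
  have hint : ∀ k, Integrable (fun z : UnitSphere n × UnitSphere n =>
      a k * inner ℝ (z.1 : EuclideanSpace ℝ (Fin n)) (z.2 : EuclideanSpace ℝ (Fin n)) ^ k)
      (μ.prod ν) := fun k => Continuous.integrable_of_compactSpace (by fun_prop)
  have := hasSum_integral_of_summable_integral_norm hint ?_
  · simp only [integral_const_mul] at this
    simp only [← sphereEnergy_pow]
    have he : sphereEnergy g μ ν = ∫ z, (∑' k, a k * inner ℝ
        (z.1 : EuclideanSpace ℝ (Fin n)) (z.2 : EuclideanSpace ℝ (Fin n)) ^ k) ∂μ.prod ν :=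
      integral_congr_ae (.of_forall fun z => (h.hasSum _ (inner_mem_Icc z.1 z.2)).tsum_eq.symm)
    rwa [he]
  · refine Summable.of_nonneg_of_le (fun k => integral_nonneg fun _ => norm_nonneg _)
      (fun k => ?_) h.summable
    calc _ ≤ ∫ _ : UnitSphere n × UnitSphere n, a k ∂μ.prod ν := by
          refine integral_mono (hint k).norm (integrable_const _) fun z => ?_
          simp only [Real.norm_eq_abs, abs_mul, abs_pow, abs_of_nonneg (h.nonneg k)]
          exact mul_le_of_le_one_right (h.nonneg k)
            (pow_le_one₀ (abs_nonneg _) (_root_.abs_le.2 (inner_mem_Icc z.1 z.2)))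
      _ = a k := by simp

/-- The energy of the signed measure `μ - ν`, expanded by bilinearity into squares of moment
differences. -/
theorem HasNonnegSeries.hasSum_sphereEnergy_sub {a : ℕ → ℝ} {g : ℝ → ℝ} (h : HasNonnegSeries a g)
    (μ ν : Measure (UnitSphere n)) [IsProbabilityMeasure μ] [IsProbabilityMeasure ν] :
    HasSum (fun k => a k * ∑ f : Fin k → Fin n, (sphereMoment μ f - sphereMoment ν f) ^ 2)
      (sphereEnergy g μ μ - 2 * sphereEnergy g μ ν + sphereEnergy g ν ν) := by
  refine Eq.subst (motive := fun w : ℕ → ℝ => HasSum w _) (funext fun k => ?_)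
    (((h.hasSum_sphereEnergy μ μ).sub ((h.hasSum_sphereEnergy μ ν).mul_left 2)).add
      (h.hasSum_sphereEnergy ν ν))
  have : ∀ f : Fin k → Fin n, (sphereMoment μ f - sphereMoment ν f) ^ 2 =
      sphereMoment μ f * sphereMoment μ f - 2 * (sphereMoment μ f * sphereMoment ν f) +
        sphereMoment ν f * sphereMoment ν f := fun f => by ring
  simp only [this, Finset.sum_add_distrib, Finset.sum_sub_distrib, ← Finset.mul_sum]
  ring

open BoundedContinuousFunction in
/-- A finite measure on the sphere is determined by its moments. -/
theorem eq_of_sphereMoment_eq {μ ν : Measure (UnitSphere n)} [IsFiniteMeasure μ]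
    [IsFiniteMeasure ν]
    (h : ∀ (k : ℕ) (f : Fin k → Fin n), sphereMoment μ f = sphereMoment ν f) : μ = ν := by
  let X : Fin n → (UnitSphere n →ᵇ ℝ) := fun i => mkOfCompact
    ⟨fun x => (x : EuclideanSpace ℝ (Fin n)) i, by fun_prop⟩
  have hX : ∀ i x, X i x = (x : EuclideanSpace ℝ (Fin n)) i := fun i x => rfl
  -- Monomials are closed under products, so they span the algebra of polynomial functions, which
  -- separates points.
  have hmon : ∀ g ∈ Submonoid.closure (Set.range X), ∃ (k : ℕ) (f : Fin k → Fin n),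
      ∀ x, g x = ∏ j, (x : EuclideanSpace ℝ (Fin n)) (f j) := by
    intro g hg
    induction hg using Submonoid.closure_induction with
    | mem g hg =>
      obtain ⟨i, rfl⟩ := hg
      exact ⟨1, fun _ => i, fun x => by simp [hX]⟩
    | one => exact ⟨0, Fin.elim0, fun x => by simp⟩
    | mul g₁ g₂ _ _ h₁ h₂ =>
      obtain ⟨k, f, hf⟩ := h₁
      obtain ⟨l, f', hf'⟩ := h₂
      exact ⟨k + l, Fin.append f f', fun x => by simp [Fin.prod_univ_add, hf, hf']⟩
  let A : StarSubalgebra ℝ (UnitSphere n →ᵇ ℝ) :=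
    { Algebra.adjoin ℝ (Set.range X) with
      star_mem' := fun {g} hg => by
        have : star g = g := by ext x; simp
        rwa [this] }
  have hA : ∀ g, g ∈ A ↔ g ∈ Algebra.adjoin ℝ (Set.range X) := fun g => Iff.rfl
  refine ext_of_forall_mem_subalgebra_integral_eq_of_polish (𝕜 := ℝ) (A := A) ?_ ?_
  · intro x y hxy
    obtain ⟨i, hi⟩ : ∃ i, (x : EuclideanSpace ℝ (Fin n)) i ≠ (y : EuclideanSpace ℝ (Fin n)) i := by
      by_contra! hall
      exact hxy (Subtype.ext (PiLp.ext hall))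
    exact ⟨X i, ⟨toContinuousMapStarₐ ℝ (X i),
      ⟨X i, Algebra.subset_adjoin ⟨i, rfl⟩, rfl⟩, rfl⟩, hi⟩
  · intro g hg
    rw [hA, ← Subalgebra.mem_toSubmodule, Algebra.adjoin_eq_span] at hg
    induction hg using Submodule.span_induction with
    | mem g hg =>
      obtain ⟨k, f, hf⟩ := hmon g hg
      simp only [hf]
      exact h k f
    | zero => simp
    | add g₁ g₂ _ _ h₁ h₂ =>
      simp only [BoundedContinuousFunction.coe_add, Pi.add_apply]
      rw [integral_add (g₁.integrable μ) (g₂.integrable μ),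
        integral_add (g₁.integrable ν) (g₂.integrable ν), h₁, h₂]
    | smul c g _ hg =>
      simp only [BoundedContinuousFunction.coe_smul, integral_smul, hg]

end Moments

/-! ### Rotation invariance of the uniform measure -/

section Uniform

variable {n : ℕ}

/-- The action of a linear isometry of `ℝⁿ` on the unit sphere. -/
noncomputable def sphereIsometry (L : EuclideanSpace ℝ (Fin n) ≃ₗᵢ[ℝ] EuclideanSpace ℝ (Fin n))
    (x : UnitSphere n) : UnitSphere n :=
  ⟨L x, by simp⟩

open scoped Pointwise in
theorem measurePreserving_sphereIsometry
    (L : EuclideanSpace ℝ (Fin n) ≃ₗᵢ[ℝ] EuclideanSpace ℝ (Fin n)) :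
    MeasurePreserving (sphereIsometry L) (uniformSphereMeasure n) (uniformSphereMeasure n) := by
  have hc : Continuous (sphereIsometry L) :=
    (L.continuous.comp continuous_subtype_val).subtype_mk _
  refine MeasurePreserving.smul_measure ⟨hc.measurable, Measure.ext fun s hs => ?_⟩ _
  rw [Measure.map_apply hc.measurable hs, Measure.toSphere_apply' _ hs,
    Measure.toSphere_apply' _ (hc.measurable hs)]
  congr 1
  -- The surface measure of `s` comes from the volume of the cone `(0, 1) • s`, and `L` preserves
  -- volume and commutes with forming cones.
  rw [← L.measurePreserving.measure_preimage_emb L.toHomeomorph.measurableEmbedding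
    (Set.Ioo (0 : ℝ) 1 • (Subtype.val '' s))]
  congr 1
  ext v
  simp only [Set.mem_smul, Set.mem_preimage, Set.mem_image]
  constructor
  · rintro ⟨r, hr, _, ⟨x, hx, rfl⟩, rfl⟩
    exact ⟨r, hr, _, ⟨sphereIsometry L x, hx, rfl⟩, by simp [sphereIsometry]⟩
  · rintro ⟨r, hr, _, ⟨x, hx, rfl⟩, hv⟩
    refine ⟨r, hr, _, ⟨sphereIsometry L.symm x, ?_, rfl⟩, ?_⟩
    · simpa [sphereIsometry] using hx
    · apply L.injective
      simpa [sphereIsometry] using hv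

theorem isProbabilityMeasure_uniformSphereMeasure (hn : 1 ≤ n) :
    IsProbabilityMeasure (uniformSphereMeasure n) := by
  have : Nontrivial (EuclideanSpace ℝ (Fin n)) := by
    have : Nonempty (Fin n) := ⟨⟨0, hn⟩⟩
    infer_instance
  refine ⟨?_⟩
  rw [uniformSphereMeasure, Measure.smul_apply, smul_eq_mul]
  refine ENNReal.inv_mul_cancel ?_ (measure_ne_top _ _)
  rw [Ne, Measure.measure_univ_eq_zero]
  exact Measure.toSphere_ne_zero _

/-- The potential of the uniform measure is constant. -/
theorem integral_inner_uniformSphereMeasure (g : ℝ → ℝ) (x x' : UnitSphere n) :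
    ∫ y, g (inner ℝ (x : EuclideanSpace ℝ (Fin n)) (y : EuclideanSpace ℝ (Fin n)))
        ∂uniformSphereMeasure n =
      ∫ y, g (inner ℝ (x' : EuclideanSpace ℝ (Fin n)) (y : EuclideanSpace ℝ (Fin n)))
        ∂uniformSphereMeasure n := by
  -- The reflection in the hyperplane orthogonal to `x - x'` carries `x` to `x'`.
  let L := (Submodule.span ℝ {(x : EuclideanSpace ℝ (Fin n)) - x'})ᗮ.reflection
  have hL : L x = x' := Submodule.reflection_sub (by simp)
  have hemb : MeasurableEmbedding (sphereIsometry L) := by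
    have hc : ∀ L : EuclideanSpace ℝ (Fin n) ≃ₗᵢ[ℝ] EuclideanSpace ℝ (Fin n),
        Continuous (sphereIsometry L) := fun L =>
      (L.continuous.comp continuous_subtype_val).subtype_mk _
    exact (Homeomorph.mk ⟨sphereIsometry L, sphereIsometry L.symm,
      fun x => by simp [sphereIsometry], fun x => by simp [sphereIsometry]⟩
      (hc L) (hc L.symm)).measurableEmbedding
  rw [← (measurePreserving_sphereIsometry L).integral_comp hemb
    (fun y => g (inner ℝ (x' : EuclideanSpace ℝ (Fin n)) (y : EuclideanSpace ℝ (Fin n))))]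
  simp only [sphereIsometry, ← hL, LinearIsometryEquiv.inner_map_map]

/-- Integrating a constant potential against any probability measure gives that constant. -/
theorem sphereEnergy_uniformSphereMeasure (hn : 1 ≤ n) {g : ℝ → ℝ} (hg : Continuous g)
    (μ : Measure (UnitSphere n)) [IsProbabilityMeasure μ] :
    sphereEnergy g μ (uniformSphereMeasure n) =
      sphereEnergy g (uniformSphereMeasure n) (uniformSphereMeasure n) := by
  have := isProbabilityMeasure_uniformSphereMeasure hn
  have key : ∀ (x₀ : UnitSphere n) (ν : Measure (UnitSphere n)) [IsProbabilityMeasure ν],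
      sphereEnergy g ν (uniformSphereMeasure n) =
      ∫ y, g (inner ℝ (x₀ : EuclideanSpace ℝ (Fin n)) (y : EuclideanSpace ℝ (Fin n)))
        ∂uniformSphereMeasure n := by
    intro x₀ ν _
    rw [sphereEnergy, integral_prod _ (Continuous.integrable_of_compactSpace (by fun_prop))]
    simp only [integral_inner_uniformSphereMeasure g _ x₀]
    simp
  obtain ⟨x₀⟩ : Nonempty (UnitSphere n) := (IsProbabilityMeasure.neZero μ).1 |> fun h => by
    by_contra hne
    rw [not_nonempty_iff] at hne
    exact h (Measure.eq_zero_of_isEmpty μ)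
  rw [key x₀ μ, key x₀]

end Uniform

/-! ### Energy bounds and equality cases -/

section Energy

variable {n : ℕ}

theorem continuous_geodesicDist :
    Continuous fun z : UnitSphere n × UnitSphere n => geodesicDist z.1 z.2 := by
  simp only [geodesicDist_eq_arccos]
  exact Real.continuous_arccos.comp (by fun_prop)

theorem continuous_geodesicDist_rpow {δ : ℝ} (hδ : 0 < δ) :
    Continuous fun z : UnitSphere n × UnitSphere n => geodesicDist z.1 z.2 ^ δ :=
  continuous_geodesicDist.rpow_const fun _ => Or.inr hδ.le

theorem geodesicDist_nonneg (x y : UnitSphere n) : 0 ≤ geodesicDist x y :=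
  InnerProductGeometry.angle_nonneg _ _

theorem geodesicDist_le_pi (x y : UnitSphere n) : geodesicDist x y ≤ Real.pi :=
  InnerProductGeometry.angle_le_pi _ _

theorem geodesicDist_eq_zero_iff {x y : UnitSphere n} : geodesicDist x y = 0 ↔ x = y := by
  rw [geodesicDist_eq_arccos, Real.arccos_eq_zero, Subtype.ext_iff,
    ← inner_eq_one_iff_of_norm_eq_one (𝕜 := ℝ) (norm_eq_of_mem_sphere x) (norm_eq_of_mem_sphere y)]
  exact ⟨fun h => le_antisymm (inner_mem_Icc x y).2 h, fun h => h.ge⟩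

theorem geodesicDist_neg_right (x y : UnitSphere n) :
    geodesicDist x (-y) = Real.pi - geodesicDist x y := by
  simp [geodesicDist, InnerProductGeometry.angle_neg_right]

theorem geodesicDist_comm (x y : UnitSphere n) : geodesicDist x y = geodesicDist y x :=
  InnerProductGeometry.angle_comm _ _

theorem geodesicEnergy_eq_integral_prod {δ : ℝ} (hδ : 0 < δ) (μ : Measure (UnitSphere n))
    [IsProbabilityMeasure μ] :
    geodesicEnergy δ μ = ∫ z, geodesicDist z.1 z.2 ^ δ ∂μ.prod μ :=
  (integral_prod_symm _ (continuous_geodesicDist_rpow hδ).integrable_of_compactSpace).symm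

theorem geodesicEnergy_one (μ : Measure (UnitSphere n)) [IsProbabilityMeasure μ] :
    geodesicEnergy 1 μ = Real.pi / 2 - sphereEnergy Real.arcsin μ μ := by
  rw [geodesicEnergy_eq_integral_prod one_pos, sphereEnergy]
  simp only [Real.rpow_one, geodesicDist_eq_arccos, Real.arccos]
  rw [integral_sub (integrable_const _) (Continuous.integrable_of_compactSpace
    (by have := Real.continuous_arcsin; fun_prop))]
  simp

theorem sphereMoment_map_neg (μ : Measure (UnitSphere n)) {k : ℕ} (f : Fin k → Fin n) :
    sphereMoment (μ.map fun x => -x) f = (-1) ^ k * sphereMoment μ f := by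
  rw [sphereMoment, integral_map continuous_neg.measurable.aemeasurable
    (Continuous.aestronglyMeasurable (by fun_prop)), sphereMoment, ← integral_const_mul]
  congr 1
  ext x
  simp [Finset.prod_neg]

theorem geodesicEnergy_one_le (μ : Measure (UnitSphere n)) [IsProbabilityMeasure μ] :
    geodesicEnergy 1 μ ≤ Real.pi / 2 := by
  obtain ⟨a, ha, -⟩ := exists_hasNonnegSeries_arcsin
  rw [geodesicEnergy_one]
  have := (ha.hasSum_sphereEnergy μ μ).nonneg fun k => mul_nonneg (ha.nonneg k)
    (Finset.sum_nonneg fun f _ => mul_self_nonneg _)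
  linarith

/-- The antipodal map multiplies degree `k` moments by `(-1) ^ k`, so symmetry means that odd
moments vanish. Conversely, for symmetric `μ`, negating one variable changes the sign of the arcsine
energy. -/
theorem geodesicEnergy_one_eq_iff (μ : Measure (UnitSphere n)) [IsProbabilityMeasure μ] :
    geodesicEnergy 1 μ = Real.pi / 2 ↔ IsCentrallySymmetric μ := by
  obtain ⟨a, ha, hpos⟩ := exists_hasNonnegSeries_arcsin
  have hsum := ha.hasSum_sphereEnergy μ μ
  have hnn : ∀ k, 0 ≤ a k * ∑ f : Fin k → Fin n, sphereMoment μ f * sphereMoment μ f := fun k =>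
    mul_nonneg (ha.nonneg k) (Finset.sum_nonneg fun f _ => mul_self_nonneg _)
  rw [geodesicEnergy_one, sub_eq_self, IsCentrallySymmetric]
  constructor
  · intro h
    rw [h, hasSum_zero_iff_of_nonneg hnn] at hsum
    have : IsProbabilityMeasure (μ.map fun x => -x) :=
      Measure.isProbabilityMeasure_map continuous_neg.measurable.aemeasurable
    refine eq_of_sphereMoment_eq fun k f => ?_
    rw [sphereMoment_map_neg]
    rcases Nat.even_or_odd k with hk | hk
    · rw [hk.neg_one_pow, one_mul]
    · have h0 := (mul_eq_zero.1 (congrFun hsum k)).resolve_left (hpos k hk).ne'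
      rw [Finset.sum_eq_zero_iff_of_nonneg fun f _ => mul_self_nonneg _] at h0
      rw [mul_self_eq_zero.1 (h0 f (Finset.mem_univ f)), mul_zero]
  · intro h
    rw [sphereEnergy]
    have hemb : MeasurableEmbedding
        (Prod.map id Neg.neg : UnitSphere n × UnitSphere n → UnitSphere n × UnitSphere n) :=
      ((Homeomorph.refl _).prodCongr (Homeomorph.neg (UnitSphere n))).measurableEmbedding
    have hmp : MeasurePreserving (Prod.map id Neg.neg) (μ.prod μ) (μ.prod μ) :=
      (MeasurePreserving.id μ).prod ⟨continuous_neg.measurable, h⟩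
    have := hmp.integral_comp hemb (fun z => Real.arcsin
      (inner ℝ (z.1 : EuclideanSpace ℝ (Fin n)) (z.2 : EuclideanSpace ℝ (Fin n))))
    simp only [Prod.map_fst, Prod.map_snd, id_eq, coe_neg_sphere, inner_neg_right,
      Real.arcsin_neg, integral_neg] at this
    linarith

/-- The measure `(δ_p + δ_{-p}) / 2`. -/
noncomputable def antipodalMeasure (p : UnitSphere n) : Measure (UnitSphere n) :=
  (2 : ENNReal)⁻¹ • (Measure.dirac p + Measure.dirac (-p))

instance (p : UnitSphere n) : IsProbabilityMeasure (antipodalMeasure p) := by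
  refine ⟨?_⟩
  simp [antipodalMeasure, ENNReal.inv_two_add_inv_two]

theorem integral_antipodalMeasure (p : UnitSphere n) (f : UnitSphere n → ℝ) :
    ∫ x, f x ∂antipodalMeasure p = (f p + f (-p)) / 2 := by
  rw [antipodalMeasure, integral_smul_measure, integral_add_measure
    (integrable_dirac (by simp)) (integrable_dirac (by simp)), integral_dirac, integral_dirac]
  simp
  ring

theorem geodesicEnergy_antipodalMeasure {δ : ℝ} (hδ : 0 < δ) (p : UnitSphere n) :
    geodesicEnergy δ (antipodalMeasure p) = Real.pi ^ δ / 2 := by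
  have h0 : ∀ x : UnitSphere n, geodesicDist x x = 0 := fun x => geodesicDist_eq_zero_iff.2 rfl
  simp only [geodesicEnergy, integral_antipodalMeasure, geodesicDist_neg_right,
    geodesicDist_comm (-p), h0, sub_zero, sub_self, Real.zero_rpow hδ.ne']
  ring

/-- Write `t ^ δ = t ^ (δ - 1) * t` and use that the first factor is strictly increasing. -/
theorem rpow_le_pi_rpow_mul {δ t : ℝ} (hδ : 1 < δ) (h0 : 0 ≤ t) (h1 : t ≤ Real.pi) :
    t ^ δ ≤ Real.pi ^ (δ - 1) * t ∧ (t ^ δ = Real.pi ^ (δ - 1) * t → t = 0 ∨ t = Real.pi) := by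
  have h : t ^ δ = t ^ (δ - 1) * t := by
    conv_rhs => rw [← Real.rpow_add_one' h0 (by linarith)]
    rw [sub_add_cancel]
  rw [h]
  refine ⟨mul_le_mul_of_nonneg_right (Real.rpow_le_rpow h0 h1 (by linarith)) h0, fun he => ?_⟩
  by_contra! hne
  have := Real.rpow_lt_rpow h0 (lt_of_le_of_ne h1 hne.2) (by linarith : 0 < δ - 1)
  exact this.ne (mul_right_cancel₀ hne.1 he)

theorem integral_pi_rpow_mul_sub {δ : ℝ} (hδ : 1 < δ) (μ : Measure (UnitSphere n))
    [IsProbabilityMeasure μ] :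
    ∫ z, (Real.pi ^ (δ - 1) * geodesicDist z.1 z.2 - geodesicDist z.1 z.2 ^ δ) ∂μ.prod μ =
      Real.pi ^ (δ - 1) * geodesicEnergy 1 μ - geodesicEnergy δ μ := by
  rw [geodesicEnergy_eq_integral_prod one_pos, geodesicEnergy_eq_integral_prod (by linarith),
    integral_sub, integral_const_mul]
  · simp only [Real.rpow_one]
  · exact (continuous_geodesicDist.const_mul _).integrable_of_compactSpace
  · exact (continuous_geodesicDist_rpow (by linarith)).integrable_of_compactSpace

theorem geodesicEnergy_le {δ : ℝ} (hδ : 1 < δ) (μ : Measure (UnitSphere n))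
    [IsProbabilityMeasure μ] :
    geodesicEnergy δ μ ≤ Real.pi ^ (δ - 1) * geodesicEnergy 1 μ := by
  rw [← sub_nonneg, ← integral_pi_rpow_mul_sub hδ]
  exact integral_nonneg fun z => sub_nonneg.2
    (rpow_le_pi_rpow_mul hδ (geodesicDist_nonneg _ _) (geodesicDist_le_pi _ _)).1

theorem pi_rpow_sub_one_mul {δ : ℝ} :
    Real.pi ^ (δ - 1) * (Real.pi / 2) = Real.pi ^ δ / 2 := by
  rw [Real.rpow_sub_one Real.pi_ne_zero]
  field_simp

theorem geodesicEnergy_le_pi_rpow {δ : ℝ} (hδ : 1 < δ) (μ : Measure (UnitSphere n))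
    [IsProbabilityMeasure μ] : geodesicEnergy δ μ ≤ Real.pi ^ δ / 2 := by
  rw [← pi_rpow_sub_one_mul]
  exact (geodesicEnergy_le hδ μ).trans
    (mul_le_mul_of_nonneg_left (geodesicEnergy_one_le μ) (by positivity))

/-- Equality must hold in both the bound by the `δ = 1` energy and the bound on that energy. The
former concentrates `μ` on `{p, -p}` for a typical `p`; the latter gives symmetry, hence equal
weights. -/
theorem exists_eq_antipodalMeasure {δ : ℝ} (hδ : 1 < δ) (μ : Measure (UnitSphere n))
    [IsProbabilityMeasure μ] (h : geodesicEnergy δ μ = Real.pi ^ δ / 2) :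
    ∃ p, μ = antipodalMeasure p := by
  have hle := geodesicEnergy_le hδ μ
  have hpos : 0 < Real.pi ^ (δ - 1) := by positivity
  rw [h, ← pi_rpow_sub_one_mul, mul_le_mul_iff_right₀ hpos] at hle
  have h1 : geodesicEnergy 1 μ = Real.pi / 2 := le_antisymm (geodesicEnergy_one_le μ) hle
  have hsym : IsCentrallySymmetric μ := (geodesicEnergy_one_eq_iff μ).1 h1
  have h0 := integral_pi_rpow_mul_sub hδ μ
  rw [h, h1, pi_rpow_sub_one_mul, sub_self, integral_eq_zero_iff_of_nonneg
    (fun z => sub_nonneg.2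
      (rpow_le_pi_rpow_mul hδ (geodesicDist_nonneg _ _) (geodesicDist_le_pi _ _)).1)
    ((continuous_geodesicDist.const_mul _).sub
      (continuous_geodesicDist_rpow (by linarith))).integrable_of_compactSpace] at h0
  obtain ⟨p, hp⟩ := (Measure.ae_ae_of_ae_prod h0).exists
  have hp' : ∀ᵐ y ∂μ, y ∈ ({p} ∪ {-p} : Set (UnitSphere n)) := by
    filter_upwards [hp] with y hy
    rcases (rpow_le_pi_rpow_mul hδ (geodesicDist_nonneg p y) (geodesicDist_le_pi p y)).2
      (sub_eq_zero.1 hy).symm with h | h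
    · exact Or.inl (geodesicDist_eq_zero_iff.1 h).symm
    · have h' : p = -y := geodesicDist_eq_zero_iff.1 ?_
      · exact Or.inr (neg_eq_iff_eq_neg.1 h'.symm)
      rw [geodesicDist_neg_right, h, sub_self]
  have hne : p ≠ -p := by
    intro he
    have h1 := geodesicDist_neg_right p p
    rw [← he, geodesicDist_eq_zero_iff.2 rfl] at h1
    linarith [Real.pi_pos]
  have hmass : μ {-p} = μ {p} := by
    conv_rhs => rw [← hsym]
    rw [Measure.map_apply continuous_neg.measurable (measurableSet_singleton p)]
    congr 1
    ext x
    simp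
  have hμ : μ = μ {p} • (Measure.dirac p + Measure.dirac (-p)) := by
    conv_lhs => rw [← Measure.restrict_eq_self_of_ae_mem hp', Measure.restrict_union
      (by simpa using hne) (measurableSet_singleton _), Measure.restrict_singleton,
      Measure.restrict_singleton, hmass]
    rw [smul_add]
  have htot : μ {p} = 2⁻¹ := by
    have := congrArg (fun ν : Measure (UnitSphere n) => ν Set.univ) hμ
    simp only [measure_univ, Measure.smul_apply, Measure.add_apply, smul_eq_mul,
      one_add_one_eq_two] at this
    exact ENNReal.eq_inv_of_mul_eq_one_left this.symm
  refine ⟨p, ?_⟩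
  rw [antipodalMeasure, ← htot]
  exact hμ

/-- For `0 < δ < 1` the energy is strictly maximized by the uniform measure. -/
theorem geodesicEnergy_le_uniformSphereMeasure (hn : 1 ≤ n) {δ : ℝ} (h0 : 0 < δ) (h1 : δ < 1)
    (μ : Measure (UnitSphere n)) [IsProbabilityMeasure μ] :
    geodesicEnergy δ μ ≤ geodesicEnergy δ (uniformSphereMeasure n) ∧
      (geodesicEnergy δ μ = geodesicEnergy δ (uniformSphereMeasure n) →
        μ = uniformSphereMeasure n) := by
  have := isProbabilityMeasure_uniformSphereMeasure hn
  obtain ⟨a, ha, hapos⟩ := exists_hasNonnegSeries_arcsin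
  obtain ⟨b, hb, hbpos⟩ := exists_hasNonnegSeries_one_sub_rpow h0 h1
  have hπ : 0 < 2 / Real.pi := by have := Real.pi_pos; positivity
  have hu : HasNonnegSeries (fun k => 2 / Real.pi * a k) (fun t => 2 / Real.pi * Real.arcsin t) :=
    ⟨fun k => mul_nonneg hπ.le (ha.nonneg k), fun t ht => by
      simpa only [mul_assoc] using (ha.hasSum t ht).mul_left (2 / Real.pi)⟩
  -- The factor `2 / π` normalizes the inner series to the value 1 at `t = 1`.
  obtain ⟨c, hc, hbc⟩ := hb.comp hu (by
    rw [Real.arcsin_one]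
    have := Real.pi_ne_zero
    field_simp
    rfl)
  -- Even degrees are covered too, through the powers of the linear term of `arcsin`.
  have hcpos : ∀ k, k ≠ 0 → 0 < c k := fun k hk =>
    (mul_pos (hbpos k hk) (pow_pos (mul_pos hπ (hapos 1 odd_one)) k)).trans_le (hbc k)
  set g : ℝ → ℝ := fun t => 1 - (1 - 2 / Real.pi * Real.arcsin t) ^ δ with hgdef
  have hg : Continuous g := by
    refine continuous_const.sub (Continuous.rpow_const ?_ fun _ => Or.inr h0.le)
    exact continuous_const.sub (Real.continuous_arcsin.const_mul _)
  have hE : ∀ (ν : Measure (UnitSphere n)) [IsProbabilityMeasure ν],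
      geodesicEnergy δ ν = (Real.pi / 2) ^ δ * (1 - sphereEnergy g ν ν) := by
    intro ν _
    rw [geodesicEnergy_eq_integral_prod h0, sphereEnergy]
    have hone : ∫ z : UnitSphere n × UnitSphere n, (1 - g (inner ℝ
        (z.1 : EuclideanSpace ℝ (Fin n)) (z.2 : EuclideanSpace ℝ (Fin n)))) ∂ν.prod ν =
        1 - ∫ z : UnitSphere n × UnitSphere n, g (inner ℝ
        (z.1 : EuclideanSpace ℝ (Fin n)) (z.2 : EuclideanSpace ℝ (Fin n))) ∂ν.prod ν := by
      rw [integral_sub (integrable_const _) (Continuous.integrable_of_compactSpace (by fun_prop))]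
      simp
    rw [← hone, ← integral_const_mul]
    refine integral_congr_ae (.of_forall fun z => ?_)
    have hpi := Real.pi_pos
    simp only [hgdef, sub_sub_cancel, geodesicDist_eq_arccos]
    set t := inner ℝ (z.1 : EuclideanSpace ℝ (Fin n)) (z.2 : EuclideanSpace ℝ (Fin n))
    have e : 1 - 2 / Real.pi * Real.arcsin t = (Real.pi / 2)⁻¹ * Real.arccos t := by
      rw [Real.arccos]
      field_simp
    rw [e, ← Real.mul_rpow (by positivity) (mul_nonneg (by positivity) (Real.arccos_nonneg t)),
      mul_inv_cancel_left₀ (by positivity)]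
  have hsum := hc.hasSum_sphereEnergy_sub μ (uniformSphereMeasure n)
  -- The cross term becomes the energy of σ, so the sum is the excess of μ over σ.
  rw [sphereEnergy_uniformSphereMeasure hn hg μ] at hsum
  have hnn : ∀ k, 0 ≤ c k * ∑ f : Fin k → Fin n,
      (sphereMoment μ f - sphereMoment (uniformSphereMeasure n) f) ^ 2 := fun k =>
    mul_nonneg (hc.nonneg k) (Finset.sum_nonneg fun f _ => sq_nonneg _)
  have hpi : 0 < (Real.pi / 2) ^ δ := by have := Real.pi_pos; positivity
  rw [hE, hE]
  refine ⟨mul_le_mul_of_nonneg_left (by linarith [hsum.nonneg hnn]) hpi.le, fun he => ?_⟩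
  have he' := mul_left_cancel₀ hpi.ne' he
  have hz : sphereEnergy g μ μ
      - 2 * sphereEnergy g (uniformSphereMeasure n) (uniformSphereMeasure n)
      + sphereEnergy g (uniformSphereMeasure n) (uniformSphereMeasure n) = 0 := by linarith
  rw [hz, hasSum_zero_iff_of_nonneg hnn] at hsum
  refine eq_of_sphereMoment_eq fun k f => ?_
  rcases eq_or_ne k 0 with rfl | hk
  -- Positivity of `c 0` is not available, but the degree 0 moment is the total mass.
  · simp [sphereMoment]
  · have hk0 := (mul_eq_zero.1 (congrFun hsum k)).resolve_left (hcpos k hk).ne'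
    rw [Finset.sum_eq_zero_iff_of_nonneg fun f _ => sq_nonneg _] at hk0
    exact sub_eq_zero.1 (pow_eq_zero_iff two_ne_zero |>.1 (hk0 f (Finset.mem_univ f)))

end Energy

theorem mainTheorem7 (n : ℕ) (hn : 1 ≤ n) (δ : ℝ) (hδ : 0 < δ) :
    (δ < 1 → ∀ μ : Measure (UnitSphere n),
      IsGeodesicEnergyMaximizer δ μ ↔ μ = uniformSphereMeasure n) ∧
    (δ = 1 → ∀ μ : Measure (UnitSphere n),
      IsGeodesicEnergyMaximizer δ μ ↔ IsProbabilityMeasure μ ∧ IsCentrallySymmetric μ) ∧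
    (1 < δ → ∀ μ : Measure (UnitSphere n),
      IsGeodesicEnergyMaximizer δ μ ↔
        ∃ p : UnitSphere n, μ = (2 : ENNReal)⁻¹ • (Measure.dirac p + Measure.dirac (-p))) := by
  obtain ⟨p₀⟩ : Nonempty (UnitSphere n) :=
    ⟨⟨EuclideanSpace.single ⟨0, hn⟩ 1, by simp⟩⟩
  refine ⟨fun h1 μ => ⟨fun ⟨hμ, hmax⟩ => ?_, ?_⟩, ?_, fun h1 μ => ⟨fun ⟨hμ, hmax⟩ => ?_, ?_⟩⟩
  · have hle := geodesicEnergy_le_uniformSphereMeasure hn hδ h1 μ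
    exact hle.2 (le_antisymm hle.1 (hmax _ (isProbabilityMeasure_uniformSphereMeasure hn)))
  · rintro rfl
    exact ⟨isProbabilityMeasure_uniformSphereMeasure hn, fun ν hν =>
      (geodesicEnergy_le_uniformSphereMeasure hn hδ h1 ν).1⟩
  · rintro rfl μ
    refine and_congr_right fun hμ => ?_
    rw [← geodesicEnergy_one_eq_iff]
    refine ⟨fun hmax => le_antisymm (geodesicEnergy_one_le μ) ?_, fun h ν hν => ?_⟩
    · have := hmax (antipodalMeasure p₀) inferInstance
      rwa [geodesicEnergy_antipodalMeasure one_pos, Real.rpow_one] at this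
    · exact (geodesicEnergy_one_le ν).trans h.ge
  · refine exists_eq_antipodalMeasure h1 μ (le_antisymm (geodesicEnergy_le_pi_rpow h1 μ) ?_)
    rw [← geodesicEnergy_antipodalMeasure hδ p₀]
    exact hmax _ inferInstance
  · rintro ⟨p, rfl⟩
    refine ⟨inferInstanceAs (IsProbabilityMeasure (antipodalMeasure p)), fun ν hν => ?_⟩
    exact (geodesicEnergy_le_pi_rpow h1 ν).trans (geodesicEnergy_antipodalMeasure hδ p).ge
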